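/- Define the Kustaanheimo–Stiefel transform $K:\mathbb R^4\to\mathbb R^3$ by $$K(y)=\big(y_1^2-y_2^2-y_3^2+y_4^2,\; 2(y_1y_2-y_3y_4),\; 2(y_1y_3+y_2y_4)\big).$$ Let $N\ge 1$, let $U\subset\mathbb R^3$ and $U'\subset\mathbb R^{3N-3}$ be open with $0\in U$ and $x_0'\in U'$, and let $\psi:U\times U'\to\mathbb C$ be a function. Let $\mathcal U=K^{-1}(U)\subset\mathbb R^4$ and suppose that $$u:\mathcal U\times U'\to\mathbb C,\qquad u(y,x')=\psi(K(y),x'),$$ is real analytic. Then there exist an open neighbourhood $\mathcal W\subset U\times U'$ of $(0,x_0')$ in $\mathbb R^3\times\mathbb R^{3N-3}=\mathbb R^{3N}$ and real analytic functions $\psi^{(1)},\psi^{(2)}:\mathcal W\to\mathbb C$ such that $$\psi(x,x')=\psi^{(1)}(x,x')+|x|\,\psi^{(2)}(x,x')\qquad\text{for all }(x,x')\in\mathcal W,$$ where $|x|$ is the Euclidean norm of $x\in\mathbb R^3$. -/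

import Mathlib

/-- The Kustaanheimo-Stiefel transform `K : ℝ⁴ → ℝ³`. The coordinates `y₁, y₂, y₃, y₄` of the
usual notation are `y 0, y 1, y 2, y 3` here. -/
noncomputable def ksTransform (y : EuclideanSpace ℝ (Fin 4)) : EuclideanSpace ℝ (Fin 3) :=
  !₂[y 0 ^ 2 - y 1 ^ 2 - y 2 ^ 2 + y 3 ^ 2,
     2 * (y 0 * y 1 - y 2 * y 3),
     2 * (y 0 * y 2 + y 1 * y 3)]

open Finset Filter Topology

/-! The function `u = ψ ∘ K` is constant along the circle action that preserves the fibres of `K`.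
In the coordinates z₁ = y₁ + iy₄, z₂ = y₂ + iy₃ this action is z₁ ↦ e^{iθ}z₁, z₂ ↦ e^{-iθ}z₂.
Averaging the power series of `u` in z₁, z̄₁, z₂, z̄₂ over θ leaves only the monomials of weight
zero, and these are monomials in |z₁|², |z₂|², z₁z₂, z̄₁z̄₂
(`AnalyticAt.exists_eq_comp_hopfInvariant`).

On a fibre these invariants are (|x| ± x₁)/2 and (x₂ ± ix₃)/2, since |y|² = |x|. Hence ψ(x, x') =
G(|x|, x, x') near the base point with G analytic. Splitting G into even and odd parts in its first
variable (`AnalyticAt.exists_even_odd`) gives the claim, because |x|² is a polynomial in x.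

Both reductions regroup power series, so analytic functions are handled as absolutely summable
families of monomials over an arbitrary index type. Exponents may repeat, so coefficients never need
to be collected. -/

/-! ### Analytic functions as summable families of monomials -/

theorem exists_multilinear_monomial {σ : Type*} [Fintype σ] (e : σ → ℕ) (d : ℕ) :
    ∃ M : ContinuousMultilinearMap ℂ (fun _ : Fin d => σ → ℂ) ℂ, ‖M‖ ≤ 1 ∧
      ∀ s : σ → ℂ, M (fun _ => s) = if ∑ k, e k = d then ∏ k, s k ^ e k else 0 := by
  by_cases h : ∑ k, e k = d
  · have hc : Fintype.card (Σ k, Fin (e k)) = d := by simp [h]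
    let φ : (Σ k, Fin (e k)) ≃ Fin d := Fintype.equivFinOfCardEq hc
    refine ⟨(ContinuousMultilinearMap.mkPiAlgebra ℂ (Fin d) ℂ).compContinuousLinearMap
      (fun j => ContinuousLinearMap.proj (φ.symm j).1), ?_, fun s => ?_⟩
    · refine ContinuousMultilinearMap.opNorm_le_bound zero_le_one fun m => ?_
      simp only [ContinuousMultilinearMap.compContinuousLinearMap_apply,
        ContinuousMultilinearMap.mkPiAlgebra_apply, ContinuousLinearMap.proj_apply, norm_prod,
        one_mul]
      exact Finset.prod_le_prod (fun _ _ => norm_nonneg _) fun j _ => norm_le_pi_norm (m j) _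
    · simp only [ContinuousMultilinearMap.compContinuousLinearMap_apply,
        ContinuousMultilinearMap.mkPiAlgebra_apply, ContinuousLinearMap.proj_apply, h, if_true]
      rw [Equiv.prod_comp φ.symm (fun x => s x.1), Fintype.prod_sigma]
      simp
  · exact ⟨0, by simp, fun s => by simp [h]⟩

theorem norm_monomial_le {σ : Type*} [Fintype σ] (e : σ → ℕ) (s : σ → ℂ) {ρ : ℝ}
    (hs : ‖s‖ ≤ ρ) : ‖∏ k, s k ^ e k‖ ≤ ρ ^ ∑ k, e k := by
  rw [norm_prod, ← Finset.prod_pow_eq_pow_sum]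
  refine Finset.prod_le_prod (fun _ _ => norm_nonneg _) fun k _ => ?_
  rw [norm_pow]
  exact pow_le_pow_left₀ (norm_nonneg _) ((norm_le_pi_norm s k).trans hs) _

theorem summable_monomial {σ ι : Type*} [Fintype σ] {c : ι → ℂ} {e : ι → σ → ℕ} {ρ : ℝ}
    (hc : Summable fun i => ‖c i‖ * ρ ^ ∑ k, e i k) {s : σ → ℂ} (hs : ‖s‖ ≤ ρ) :
    Summable fun i => ‖c i * ∏ k, s k ^ e i k‖ :=
  hc.of_nonneg_of_le (fun _ => norm_nonneg _) fun i => by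
    rw [norm_mul]; gcongr; exact norm_monomial_le _ _ hs

/-- Grouping the monomials by total degree gives a formal multilinear series. Absolute summability
bounds its radius from below by ρ and justifies exchanging the sums over indices and degrees. -/
theorem analyticAt_tsum_monomial {σ ι : Type*} [Fintype σ] {c : ι → ℂ} {e : ι → σ → ℕ} {ρ : ℝ}
    (hρ : 0 < ρ) (hc : Summable fun i => ‖c i‖ * ρ ^ ∑ k, e i k) :
    AnalyticAt ℂ (fun s : σ → ℂ => ∑' i, c i * ∏ k, s k ^ e i k) 0 := by
  classical
  choose M hM1 hM using fun i d => exists_multilinear_monomial (e i) d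
  let c' : ℕ → ι → ℂ := fun d i => if ∑ k, e i k = d then c i else 0
  have hc' : ∀ d i, ‖c' d i • M i d‖ * ρ ^ d ≤ ‖c i‖ * ρ ^ ∑ k, e i k := by
    intro d i
    by_cases h : ∑ k, e i k = d
    · simp only [c', h, if_true, norm_smul]
      gcongr
      exact mul_le_of_le_one_right (norm_nonneg _) (hM1 i d)
    · rw [norm_smul, show c' d i = 0 from if_neg h, norm_zero, zero_mul, zero_mul]
      positivity
  have hS : ∀ d, Summable fun i => ‖c' d i • M i d‖ := fun d => by
    refine (summable_mul_right_iff (pow_pos hρ d).ne').1 ?_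
    exact hc.of_nonneg_of_le (fun i => by positivity) (hc' d)
  let q : FormalMultilinearSeries ℂ (σ → ℂ) ℂ := fun d => ∑' i, c' d i • M i d
  have hq : ∀ d, ‖q d‖ * ρ ^ d ≤ ∑' i, ‖c i‖ * ρ ^ ∑ k, e i k := fun d => by
    calc ‖q d‖ * ρ ^ d ≤ (∑' i, ‖c' d i • M i d‖) * ρ ^ d := by
          gcongr; exact norm_tsum_le_tsum_norm (hS d)
      _ = ∑' i, ‖c' d i • M i d‖ * ρ ^ d := tsum_mul_right.symm
      _ ≤ _ := Summable.tsum_le_tsum (hc' d) ((hS d).mul_right _) hc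
  lift ρ to NNReal using hρ.le
  refine ⟨q, ρ, ?_, by exact_mod_cast hρ, fun {y} hy => ?_⟩
  · exact q.le_radius_of_bound _ hq
  · have hy' : ‖y‖ ≤ ρ := by
      have := Metric.mem_eball.1 hy
      rw [edist_zero_right] at this
      exact_mod_cast enorm_le_coe.1 this.le
    have hs := summable_monomial hc hy'
    have hqy : ∀ d, q d (fun _ => y) =
        ∑' i, if ∑ k, e i k = d then c i * ∏ k, y k ^ e i k else 0 := fun d => by
      let ev : ContinuousMultilinearMap ℂ (fun _ : Fin d => σ → ℂ) ℂ →L[ℂ] ℂ :=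
        ContinuousMultilinearMap.apply ℂ (fun _ : Fin d => σ → ℂ) ℂ (fun _ => y)
      have := ev.map_tsum (hS d).of_norm
      change ev (q d) = _
      rw [this]
      refine tsum_congr fun i => ?_
      change c' d i • M i d (fun _ => y) = _
      rw [hM]
      by_cases h : ∑ k, e i k = d <;> simp [c', h]
    simp only [hqy, zero_add]
    have h2 : Summable (Function.uncurry fun (i : ι) (d : ℕ) =>
        if ∑ k, e i k = d then c i * ∏ k, y k ^ e i k else 0) := by
      refine Summable.of_norm ?_
      refine (summable_prod_of_nonneg fun _ => norm_nonneg _).2 ⟨fun i => ?_, ?_⟩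
      · exact summable_of_ne_finset_zero (s := {∑ k, e i k}) fun d hd => by
          simp at hd; simp [Ne.symm hd]
      · convert hs using 2 with i
        rw [tsum_eq_single (∑ k, e i k)] <;> simp +contextual [eq_comm]
    have h3 := h2.prod_symm.hasSum.prod_fiberwise (fun d => (h2.prod_symm.prod_factor d).hasSum)
    have h4 : ∑' b : ℕ × ι, (Function.uncurry fun (i : ι) (d : ℕ) =>
        if ∑ k, e i k = d then c i * ∏ k, y k ^ e i k else 0) b.swap
        = ∑' i, c i * ∏ k, y k ^ e i k := by
      refine ((Equiv.prodComm ℕ ι).tsum_eq (Function.uncurry fun (i : ι) (d : ℕ) =>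
        if ∑ k, e i k = d then c i * ∏ k, y k ^ e i k else 0)).trans ?_
      rw [h2.tsum_prod]
      refine tsum_congr fun i => ?_
      simp only [Function.uncurry]
      rw [tsum_eq_single (∑ k, e i k)] <;> simp +contextual [eq_comm]
    rw [h4] at h3
    exact h3

/-- Expanding each multilinear term in the standard basis gives one monomial per word in the
variables, with exponents counting letters. The case 𝕜 = ℝ yields complexifications, the case 𝕜 = ℂ
the regroupings. -/
theorem AnalyticAt.exists_hasSum_monomial {𝕜 σ : Type*} [NontriviallyNormedField 𝕜]
    [NormedAlgebra 𝕜 ℂ] [Fintype σ] {f : (σ → 𝕜) → ℂ} (hf : AnalyticAt 𝕜 f 0) :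
    ∃ (c : (Σ n, Fin n → σ) → ℂ) (e : (Σ n, Fin n → σ) → σ → ℕ) (ρ : ℝ), 0 < ρ ∧
      (Summable fun i => ‖c i‖ * ρ ^ ∑ k, e i k) ∧
      ∀ s : σ → 𝕜, ‖s‖ ≤ ρ →
        HasSum (fun i => c i * ∏ k, algebraMap 𝕜 ℂ (s k) ^ e i k) (f s) := by
  classical
  obtain ⟨p, R, hp⟩ := hf
  obtain ⟨r, hr0, hrR⟩ : ∃ r : NNReal, 0 < r ∧ (r : ENNReal) < R := by
    obtain ⟨r, h1, h2⟩ := ENNReal.lt_iff_exists_nnreal_btwn.1 hp.r_pos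
    exact ⟨r, by exact_mod_cast h1, h2⟩
  obtain ⟨C, hC, hpC⟩ := p.norm_mul_pow_le_of_lt_radius (hrR.trans_le hp.r_le)
  -- There are (card σ)^n words of length n; this shrinking still leaves the geometric bound C /
  -- 2^n.
  set ρ : ℝ := r / (2 * (Fintype.card σ + 1)) with hρ
  have hr0' : (0 : ℝ) < r := by exact_mod_cast hr0
  have hρ0 : 0 < ρ := by positivity
  have hρr : ρ < r := by
    rw [hρ, div_lt_iff₀ (by positivity)]
    nlinarith [(Nat.cast_nonneg (Fintype.card σ) : (0 : ℝ) ≤ _)]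
  let c : (Σ n, Fin n → σ) → ℂ := fun i => p i.1 (fun j => Pi.single (i.2 j) 1)
  let e : (Σ n, Fin n → σ) → σ → ℕ := fun i k => #{j | i.2 j = k}
  have he : ∀ i, ∑ k, e i k = i.1 := fun i => by
    have := Finset.card_eq_sum_card_fiberwise (f := i.2) (s := univ) (t := univ) (by simp)
    simpa using this.symm
  have hcn : ∀ i, ‖c i‖ ≤ ‖p i.1‖ := fun i => by
    refine ((p i.1).le_opNorm _).trans (mul_le_of_le_one_right (norm_nonneg _) ?_)
    refine Finset.prod_le_one (fun _ _ => norm_nonneg _) fun j _ => ?_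
    rw [Pi.norm_single, norm_one]
  have hsum : Summable fun i => ‖c i‖ * ρ ^ ∑ k, e i k := by
    refine (summable_sigma_of_nonneg fun _ => by positivity).2
      ⟨fun n => (hasSum_fintype _).summable, ?_⟩
    have hg : Summable fun n : ℕ => C * (1 / 2 : ℝ) ^ n :=
      (summable_geometric_of_lt_one (by norm_num) (by norm_num)).mul_left C
    refine hg.of_nonneg_of_le (fun n => tsum_nonneg fun _ => by positivity) fun n => ?_
    rw [tsum_fintype]
    have h1 : (Fintype.card σ : ℝ) * ρ ≤ r * (1 / 2) := by
      rw [hρ, ← mul_div_assoc, div_le_iff₀ (by positivity)]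
      nlinarith
    calc ∑ w : Fin n → σ, ‖c ⟨n, w⟩‖ * ρ ^ ∑ k, e ⟨n, w⟩ k
        ≤ ∑ w : Fin n → σ, ‖p n‖ * ρ ^ n := by
          refine Finset.sum_le_sum fun w _ => ?_
          rw [he]; gcongr; exact hcn ⟨n, w⟩
      _ = ‖p n‖ * (Fintype.card σ * ρ) ^ n := by
          simp [mul_pow]; ring
      _ ≤ ‖p n‖ * (r * (1 / 2)) ^ n := by gcongr
      _ = (‖p n‖ * r ^ n) * (1 / 2) ^ n := by rw [mul_pow]; ring
      _ ≤ C * (1 / 2) ^ n := by gcongr; exact hpC n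
  refine ⟨c, e, ρ, hρ0, hsum, fun s hs => ?_⟩
  have hs' : Summable fun i => c i * ∏ k, algebraMap 𝕜 ℂ (s k) ^ e i k := by
    refine (summable_monomial hsum (s := fun k => algebraMap 𝕜 ℂ (s k)) ?_).of_norm
    refine (pi_norm_le_iff_of_nonneg hρ0.le).2 fun k => ?_
    rw [norm_algebraMap']
    exact (norm_le_pi_norm s k).trans hs
  have hmem : s ∈ Metric.eball (0 : σ → 𝕜) R := by
    rw [Metric.mem_eball, edist_zero_right]
    refine lt_of_le_of_lt ?_ hrR
    have : ‖s‖ ≤ r := hs.trans hρr.le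
    exact enorm_le_coe.2 (by exact_mod_cast this)
  have h1 := hp.hasSum hmem
  have h2 := hs'.hasSum.sigma (fun n => hasSum_fintype _)
  have h3 : ∀ n, p n (fun _ => s) =
      ∑ w : Fin n → σ, c ⟨n, w⟩ * ∏ k, algebraMap 𝕜 ℂ (s k) ^ e ⟨n, w⟩ k := fun n => by
    have hs1 : (fun _ : Fin n => s) = fun _ => ∑ k, s k • (Pi.single k 1 : σ → 𝕜) := by
      funext _
      ext k
      simp [Finset.sum_apply, Pi.single_apply]
    rw [hs1, (p n).map_sum]
    refine Finset.sum_congr rfl fun w _ => ?_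
    rw [(p n).map_smul_univ (fun j => s (w j)), Algebra.smul_def, map_prod, mul_comm]
    congr 1
    rw [← Finset.prod_fiberwise univ w (fun j => algebraMap 𝕜 ℂ (s (w j)))]
    refine Finset.prod_congr rfl fun k _ => ?_
    rw [Finset.prod_congr rfl (g := fun _ => algebraMap 𝕜 ℂ (s k)) (by simp +contextual)]
    simp [e]
  simp only [← h3] at h2
  rw [zero_add] at h1
  rw [h1.unique h2]
  exact hs'.hasSum

theorem AnalyticAt.exists_complexification {σ : Type*} [Fintype σ] {f : (σ → ℝ) → ℂ}
    (hf : AnalyticAt ℝ f 0) :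
    ∃ g : (σ → ℂ) → ℂ, AnalyticAt ℂ g 0 ∧ ∀ᶠ s in 𝓝 (0 : σ → ℝ), g (fun k => (s k : ℂ)) = f s := by
  obtain ⟨c, e, ρ, hρ, hc, h⟩ := hf.exists_hasSum_monomial
  refine ⟨_, analyticAt_tsum_monomial hρ hc, ?_⟩
  filter_upwards [Metric.closedBall_mem_nhds _ hρ] with s hs
  exact (h s (by simpa using hs)).tsum_eq

/-! ### Regrouping under quadratic substitutions -/

/-- A quadratic substitution at most halves degrees, so radius ρ ≤ 1 becomes ρ². The constant factor
ρ⁻¹ absorbs the `+ 1`, which arises from a single leftover odd power. -/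
theorem summable_monomial_of_card_le {ι σ τ : Type*} [Fintype σ] [Fintype τ]
    {c c' : ι → ℂ} {e : ι → σ → ℕ} {e' : ι → τ → ℕ} {ρ : ℝ} (hρ : 0 < ρ) (hρ1 : ρ ≤ 1)
    (hc : Summable fun i => ‖c i‖ * ρ ^ ∑ k, e i k) (hcc : ∀ i, c' i = 0 ∨
      c' i = c i ∧ ∑ k, e i k ≤ 2 * (∑ k, e' i k) + 1) :
    Summable fun i => ‖c' i‖ * (ρ ^ 2) ^ ∑ k, e' i k := by
  refine (hc.mul_left ρ⁻¹).of_nonneg_of_le (fun i => by positivity) fun i => ?_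
  rcases hcc i with h | ⟨h, hle⟩
  · rw [h, norm_zero, zero_mul]; positivity
  · rw [h, ← pow_mul, mul_left_comm]
    gcongr
    rw [le_inv_mul_iff₀ hρ, ← pow_succ']
    exact pow_le_pow_of_le_one hρ.le hρ1 hle

theorem AnalyticAt.exists_hasSum_monomial_le_one {σ : Type*} [Fintype σ] {f : (σ → ℂ) → ℂ}
    (hf : AnalyticAt ℂ f 0) :
    ∃ (c : (Σ n, Fin n → σ) → ℂ) (e : (Σ n, Fin n → σ) → σ → ℕ) (ρ : ℝ), 0 < ρ ∧ ρ ≤ 1 ∧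
      (Summable fun i => ‖c i‖ * ρ ^ ∑ k, e i k) ∧
      ∀ s : σ → ℂ, ‖s‖ ≤ ρ → HasSum (fun i => c i * ∏ k, s k ^ e i k) (f s) := by
  obtain ⟨c, e, ρ, hρ, hc, h⟩ := hf.exists_hasSum_monomial
  refine ⟨c, e, min ρ 1, lt_min hρ one_pos, min_le_right _ _, ?_, fun s hs =>
    h s (hs.trans (min_le_left _ _))⟩
  refine hc.of_nonneg_of_le (fun i => by positivity) fun i => ?_
  gcongr
  exact min_le_left _ _

theorem AnalyticAt.exists_even_odd {κ : Type*} [Fintype κ] {f : (Fin 1 ⊕ κ → ℂ) → ℂ}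
    (hf : AnalyticAt ℂ f 0) :
    ∃ g h : (Fin 1 ⊕ κ → ℂ) → ℂ, AnalyticAt ℂ g 0 ∧ AnalyticAt ℂ h 0 ∧
      ∀ᶠ s in 𝓝 (0 : Fin 1 ⊕ κ → ℂ),
        f s = g (Sum.elim (fun _ => s (.inl 0) ^ 2) (s ∘ .inr)) +
          s (.inl 0) * h (Sum.elim (fun _ => s (.inl 0) ^ 2) (s ∘ .inr)) := by
  obtain ⟨c, e, ρ, hρ, hρ1, hc, h⟩ := hf.exists_hasSum_monomial_le_one
  let e' : (Σ n, Fin n → Fin 1 ⊕ κ) → (Fin 1 ⊕ κ → ℕ) := fun i =>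
    Sum.elim (fun _ => e i (.inl 0) / 2) (e i ∘ .inr)
  let c₀ : (Σ n, Fin n → Fin 1 ⊕ κ) → ℂ := fun i => if e i (.inl 0) % 2 = 0 then c i else 0
  let c₁ : (Σ n, Fin n → Fin 1 ⊕ κ) → ℂ := fun i => if e i (.inl 0) % 2 = 0 then 0 else c i
  have hle : ∀ i, ∑ k, e i k ≤ 2 * (∑ k, e' i k) + 1 := fun i => by
    simp only [e', Fintype.sum_sum_type, Fin.sum_univ_one, Sum.elim_inl, Sum.elim_inr,
      Function.comp]
    omega
  have hc₀ : Summable fun i => ‖c₀ i‖ * (ρ ^ 2) ^ ∑ k, e' i k :=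
    summable_monomial_of_card_le hρ hρ1 hc fun i => by
      by_cases hi : e i (.inl 0) % 2 = 0
      · exact .inr ⟨if_pos hi, hle i⟩
      · exact .inl (if_neg hi)
  have hc₁ : Summable fun i => ‖c₁ i‖ * (ρ ^ 2) ^ ∑ k, e' i k :=
    summable_monomial_of_card_le hρ hρ1 hc fun i => by
      by_cases hi : e i (.inl 0) % 2 = 0
      · exact .inl (if_pos hi)
      · exact .inr ⟨if_neg hi, hle i⟩
  refine ⟨_, _, analyticAt_tsum_monomial (by positivity) hc₀,
    analyticAt_tsum_monomial (by positivity) hc₁, ?_⟩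
  filter_upwards [Metric.closedBall_mem_nhds _ (pow_pos hρ 2)] with s hs
  have hs2 : ‖s‖ ≤ ρ ^ 2 := by simpa using hs
  have hs1 : ‖s‖ ≤ ρ := hs2.trans (pow_le_of_le_one hρ.le hρ1 two_ne_zero)
  have hs' : ‖(Sum.elim (fun _ => s (.inl 0) ^ 2) (s ∘ .inr) : Fin 1 ⊕ κ → ℂ)‖ ≤ ρ ^ 2 := by
    refine (pi_norm_le_iff_of_nonneg (by positivity)).2 ?_
    rintro (_ | k)
    · simp only [Sum.elim_inl, norm_pow]
      gcongr
      exact (norm_le_pi_norm s _).trans hs1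
    · exact (norm_le_pi_norm s _).trans hs2
  have h0 := (summable_monomial hc₀ hs').of_norm.hasSum
  have h1 := (summable_monomial hc₁ hs').of_norm.hasSum
  refine ((h s hs1).unique ?_)
  refine (h0.add (h1.mul_left (s (.inl 0)))).congr_fun ?_
  intro i
  simp only [e', Fintype.prod_sum_type, Fin.prod_univ_one, Sum.elim_inl, Sum.elim_inr,
      Function.comp, ← pow_mul]
  by_cases hi : e i (.inl 0) % 2 = 0
  · have : 2 * (e i (.inl 0) / 2) = e i (.inl 0) := by omega
    simp [c₀, c₁, hi, this]
  · have : e i (.inl 0) = 2 * (e i (.inl 0) / 2) + 1 := by omega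
    simp only [c₀, c₁, hi, if_false]
    conv_lhs => rw [this, pow_succ]
    ring

/-! ### Invariants of the complexified circle action -/

theorem integral_exp_intCast_mul_I (n : ℤ) :
    ∫ θ in (0 : ℝ)..2 * Real.pi, Complex.exp (n * (θ * Complex.I)) =
      if n = 0 then 2 * (Real.pi : ℂ) else 0 := by
  split_ifs with h
  · simp [h]
  · have hn : (n : ℂ) * Complex.I ≠ 0 := by simp [h]
    have : ∀ θ : ℝ, Complex.exp (n * (θ * Complex.I)) = Complex.exp (n * Complex.I * θ) :=
      fun θ => by ring_nf
    simp only [this, integral_exp_mul_complex hn]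
    have h2 : (n : ℂ) * Complex.I * ((2 * Real.pi : ℝ) : ℂ) = n * (2 * Real.pi * Complex.I) := by
      push_cast; ring
    rw [h2, Complex.exp_int_mul_two_pi_mul_I]
    simp

/-- The complexified circle action on the coordinates `z₁, z̄₁, z₂, z̄₂`, of weights
`1, -1, -1, 1`, extended trivially to further coordinates. -/
noncomputable def hopfRotation {κ : Type*} (θ : ℝ) (t : Fin 4 ⊕ κ → ℂ) : Fin 4 ⊕ κ → ℂ :=
  Sum.elim ![Complex.exp (θ * Complex.I) * t (.inl 0), Complex.exp (-(θ * Complex.I)) * t (.inl 1),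
    Complex.exp (-(θ * Complex.I)) * t (.inl 2), Complex.exp (θ * Complex.I) * t (.inl 3)]
    (t ∘ .inr)

/-- The quadratic invariants `|z₁|², |z₂|², z₁z₂, z̄₁z̄₂` of `hopfRotation`. -/
def hopfInvariant {κ : Type*} (t : Fin 4 ⊕ κ → ℂ) : Fin 4 ⊕ κ → ℂ :=
  Sum.elim ![t (.inl 0) * t (.inl 1), t (.inl 2) * t (.inl 3), t (.inl 0) * t (.inl 2),
    t (.inl 1) * t (.inl 3)] (t ∘ .inr)

theorem norm_exp_mul_I_mul (θ : ℝ) (z : ℂ) : ‖Complex.exp (θ * Complex.I) * z‖ = ‖z‖ := by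
  rw [norm_mul, Complex.norm_exp_ofReal_mul_I, one_mul]

theorem norm_exp_neg_mul_I_mul (θ : ℝ) (z : ℂ) :
    ‖Complex.exp (-(θ * Complex.I)) * z‖ = ‖z‖ := by
  simpa using norm_exp_mul_I_mul (-θ) z

theorem norm_hopfRotation_le {κ : Type*} [Fintype κ] (θ : ℝ) (t : Fin 4 ⊕ κ → ℂ) :
    ‖hopfRotation θ t‖ ≤ ‖t‖ := by
  refine (pi_norm_le_iff_of_nonneg (norm_nonneg _)).2 ?_
  rintro (k | k)
  · fin_cases k
    · exact (norm_exp_mul_I_mul θ _).trans_le (norm_le_pi_norm t _)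
    · exact (norm_exp_neg_mul_I_mul θ _).trans_le (norm_le_pi_norm t _)
    · exact (norm_exp_neg_mul_I_mul θ _).trans_le (norm_le_pi_norm t _)
    · exact (norm_exp_mul_I_mul θ _).trans_le (norm_le_pi_norm t _)
  · exact norm_le_pi_norm t _

theorem prod_hopfRotation_pow {κ : Type*} [Fintype κ] (θ : ℝ) (t : Fin 4 ⊕ κ → ℂ)
    (e : Fin 4 ⊕ κ → ℕ) :
    ∏ k, hopfRotation θ t k ^ e k =
      Complex.exp (((e (.inl 0) - e (.inl 1) - e (.inl 2) + e (.inl 3) : ℤ) : ℂ) *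
        (θ * Complex.I)) * ∏ k, t k ^ e k := by
  have h : Complex.exp (((e (.inl 0) - e (.inl 1) - e (.inl 2) + e (.inl 3) : ℤ) : ℂ) *
        (θ * Complex.I)) = Complex.exp (θ * Complex.I) ^ e (.inl 0) *
          Complex.exp (-(θ * Complex.I)) ^ e (.inl 1) *
          Complex.exp (-(θ * Complex.I)) ^ e (.inl 2) * Complex.exp (θ * Complex.I) ^ e (.inl 3) := by
    simp only [← Complex.exp_nat_mul, ← Complex.exp_add]
    congr 1
    push_cast
    ring
  rw [h]
  simp only [Fintype.prod_sum_type, Fin.prod_univ_four, hopfRotation, Sum.elim_inl, Sum.elim_inr,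
    Matrix.cons_val, Function.comp]
  ring

/-- Integrating the series along the orbit of t removes every monomial of nonzero weight. Invariance
is required only at the point t: a complexified function is directly known to be invariant only at
real points. -/
theorem AnalyticAt.exists_eq_comp_hopfInvariant {κ : Type*} [Fintype κ] {f : (Fin 4 ⊕ κ → ℂ) → ℂ}
    (hf : AnalyticAt ℂ f 0) :
    ∃ g : (Fin 4 ⊕ κ → ℂ) → ℂ, AnalyticAt ℂ g 0 ∧ ∀ᶠ t in 𝓝 (0 : Fin 4 ⊕ κ → ℂ),
      (∀ θ, f (hopfRotation θ t) = f t) → f t = g (hopfInvariant t) := by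
  obtain ⟨c, e, ρ, hρ, hρ1, hc, h⟩ := hf.exists_hasSum_monomial_le_one
  let ι := Σ n, Fin n → Fin 4 ⊕ κ
  let w : ι → ℤ := fun i => e i (.inl 0) - e i (.inl 1) - e i (.inl 2) + e i (.inl 3)
  let c' : ι → ℂ := fun i => if w i = 0 then c i else 0
  -- Pair z₁ with z̄₁ and z₂ with z̄₂ as often as possible. Weight zero makes the leftovers match as
  -- powers of z₁z₂ or of z̄₁z̄₂; truncated subtraction selects which.
  let e' : ι → Fin 4 ⊕ κ → ℕ := fun i => Sum.elim
    ![min (e i (.inl 0)) (e i (.inl 1)), min (e i (.inl 2)) (e i (.inl 3)),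
      e i (.inl 0) - e i (.inl 1), e i (.inl 1) - e i (.inl 0)] (e i ∘ .inr)
  have hc' : Summable fun i => ‖c' i‖ * (ρ ^ 2) ^ ∑ k, e' i k :=
    summable_monomial_of_card_le hρ hρ1 hc fun i => by
      by_cases hi : w i = 0
      · refine .inr ⟨if_pos hi, ?_⟩
        simp only [w] at hi
        simp only [e', Fintype.sum_sum_type, Fin.sum_univ_four, Sum.elim_inl, Sum.elim_inr,
          Matrix.cons_val, Function.comp]
        omega
      · exact .inl (if_neg hi)
  refine ⟨_, analyticAt_tsum_monomial (by positivity) hc', ?_⟩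
  filter_upwards [Metric.closedBall_mem_nhds _ (pow_pos hρ 2)] with t ht hinv
  have ht2 : ‖t‖ ≤ ρ ^ 2 := by simpa using ht
  have ht1 : ‖t‖ ≤ ρ := ht2.trans (pow_le_of_le_one hρ.le hρ1 two_ne_zero)
  have h1 : ∀ θ : ℝ, HasSum (fun i => c i * (Complex.exp (w i * (θ * Complex.I)) *
      ∏ k, t k ^ e i k)) (f t) := fun θ => by
    have := h _ ((norm_hopfRotation_le θ t).trans ht1)
    rw [hinv] at this
    simpa only [prod_hopfRotation_pow] using this
  let F : ι → C(ℝ, ℂ) := fun i => ⟨fun θ => c i * (Complex.exp (w i * (θ * Complex.I)) *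
      ∏ k, t k ^ e i k), by fun_prop⟩
  have h2 : HasSum (fun i => ∫ θ in (0 : ℝ)..2 * Real.pi, F i θ)
      (∫ θ in (0 : ℝ)..2 * Real.pi, ∑' i, F i θ) := by
    refine intervalIntegral.hasSum_intervalIntegral_of_summable_norm ?_
    refine (summable_monomial hc ht1).of_nonneg_of_le (fun _ => norm_nonneg _) fun i => ?_
    refine (ContinuousMap.norm_le _ (norm_nonneg _)).2 fun θ => le_of_eq ?_
    have : Complex.exp (w i * ((θ : ℝ) * Complex.I)) =
        Complex.exp (((w i * (θ : ℝ) : ℝ) : ℂ) * Complex.I) := by push_cast; ring_nf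
    simp only [ContinuousMap.restrict_apply, F, ContinuousMap.coe_mk, this, norm_mul _ (_ * _),
      norm_exp_mul_I_mul]
    rw [norm_mul]
  have h3 : ∀ θ : ℝ, ∑' i, F i θ = f t := fun θ => (h1 θ).tsum_eq
  have h4 : ∀ i, ∫ θ in (0 : ℝ)..2 * Real.pi, F i θ =
      2 * Real.pi * (c' i * ∏ k, t k ^ e i k) := fun i => by
    simp only [F, ContinuousMap.coe_mk, intervalIntegral.integral_const_mul,
      intervalIntegral.integral_mul_const, integral_exp_intCast_mul_I]
    by_cases hi : w i = 0
    · simp only [c', hi, if_true]; ring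
    · simp [c', hi]
  simp only [h3, h4, intervalIntegral.integral_const, sub_zero, Complex.real_smul,
    Complex.ofReal_mul, Complex.ofReal_ofNat] at h2
  have h5 := (hasSum_mul_left_iff (by simp [Real.pi_ne_zero])).1 h2
  refine h5.tsum_eq.symm.trans (tsum_congr fun i => ?_)
  by_cases hi : w i = 0
  · congr 1
    simp only [w] at hi
    simp only [e', hopfInvariant, Fintype.prod_sum_type, Fin.prod_univ_four, Sum.elim_inl,
      Sum.elim_inr, Matrix.cons_val, Function.comp]
    congr 1
    rcases le_total (e i (.inl 1)) (e i (.inl 0)) with hle | hle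
    · obtain ⟨d, hd⟩ := Nat.exists_eq_add_of_le hle
      have hd' : e i (.inl 2) = d + e i (.inl 3) := by omega
      rw [hd, hd']
      simp only [Nat.le_add_right, Nat.le_add_left, min_eq_right, Nat.add_sub_cancel_left,
        Nat.sub_add_eq, Nat.sub_self, Nat.zero_sub]
      ring
    · obtain ⟨d, hd⟩ := Nat.exists_eq_add_of_le hle
      have hd' : e i (.inl 3) = d + e i (.inl 2) := by omega
      rw [hd, hd']
      simp only [Nat.le_add_right, Nat.le_add_left, min_eq_left, Nat.add_sub_cancel_left,
        Nat.sub_add_eq, Nat.sub_self, Nat.zero_sub]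
      ring
  · simp [c', hi]

/-! ### The real circle action and its complex coordinates -/

/-- The circle action on the fibres of the Kustaanheimo-Stiefel transform. -/
noncomputable def ksRotation {κ : Type*} (θ : ℝ) (s : Fin 4 ⊕ κ → ℝ) : Fin 4 ⊕ κ → ℝ :=
  Sum.elim ![Real.cos θ * s (.inl 0) - Real.sin θ * s (.inl 3),
    Real.cos θ * s (.inl 1) + Real.sin θ * s (.inl 2),
    Real.cos θ * s (.inl 2) - Real.sin θ * s (.inl 1),
    Real.cos θ * s (.inl 3) + Real.sin θ * s (.inl 0)] (s ∘ .inr)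

/-- The coordinates `z₁, z̄₁, z₂, z̄₂` with `z₁ = y₁ + i y₄` and `z₂ = y₂ + i y₃`. -/
noncomputable def ksComplexCoord {κ : Type*} (s : Fin 4 ⊕ κ → ℝ) : Fin 4 ⊕ κ → ℂ :=
  Sum.elim ![s (.inl 0) + s (.inl 3) * Complex.I, s (.inl 0) - s (.inl 3) * Complex.I,
    s (.inl 1) + s (.inl 2) * Complex.I, s (.inl 1) - s (.inl 2) * Complex.I]
    (fun k => (s (.inr k) : ℂ))

theorem hopfRotation_ksComplexCoord {κ : Type*} (θ : ℝ) (s : Fin 4 ⊕ κ → ℝ) :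
    hopfRotation θ (ksComplexCoord s) = ksComplexCoord (ksRotation θ s) := by
  have h1 : Complex.exp (θ * Complex.I) = Real.cos θ + Real.sin θ * Complex.I := by
    rw [Complex.exp_mul_I]; simp
  have h2 : Complex.exp (-(θ * Complex.I)) = Real.cos θ - Real.sin θ * Complex.I := by
    rw [← neg_mul, Complex.exp_mul_I]; simp [sub_eq_add_neg]
  funext k
  rcases k with k | k
  · fin_cases k <;>
      simp only [hopfRotation, ksComplexCoord, ksRotation, h1, h2, Sum.elim_inl, Matrix.cons_val,
        Fin.zero_eta, Fin.mk_one, Fin.reduceFinMk, Complex.ofReal_sub, Complex.ofReal_add,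
        Complex.ofReal_mul] <;>
      ring_nf <;> simp only [Complex.I_sq] <;> ring
  · rfl

theorem norm_ksRotation_le {κ : Type*} [Fintype κ] (θ : ℝ) (s : Fin 4 ⊕ κ → ℝ) :
    ‖ksRotation θ s‖ ≤ 2 * ‖s‖ := by
  have hc : ∀ k, ‖Real.cos θ * s k‖ ≤ ‖s‖ := fun k => by
    rw [norm_mul]
    exact (mul_le_of_le_one_left (norm_nonneg _) (Real.abs_cos_le_one θ)).trans (norm_le_pi_norm s k)
  have hs : ∀ k, ‖Real.sin θ * s k‖ ≤ ‖s‖ := fun k => by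
    rw [norm_mul]
    exact (mul_le_of_le_one_left (norm_nonneg _) (Real.abs_sin_le_one θ)).trans (norm_le_pi_norm s k)
  have hadd : ∀ a b, ‖Real.cos θ * s a + Real.sin θ * s b‖ ≤ 2 * ‖s‖ := fun a b => by
    linarith [norm_add_le (Real.cos θ * s a) (Real.sin θ * s b), hc a, hs b]
  have hsub : ∀ a b, ‖Real.cos θ * s a - Real.sin θ * s b‖ ≤ 2 * ‖s‖ := fun a b => by
    linarith [norm_sub_le (Real.cos θ * s a) (Real.sin θ * s b), hc a, hs b]
  refine (pi_norm_le_iff_of_nonneg (by positivity)).2 ?_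
  rintro (k | k)
  · fin_cases k
    · exact hsub _ _
    · exact hadd _ _
    · exact hsub _ _
    · exact hadd _ _
  · change ‖s (.inr k)‖ ≤ _
    linarith [norm_le_pi_norm s (.inr k), norm_nonneg s]

theorem continuous_ksComplexCoord {κ : Type*} :
    Continuous (ksComplexCoord : (Fin 4 ⊕ κ → ℝ) → Fin 4 ⊕ κ → ℂ) := by
  refine continuous_pi ?_
  rintro (k | k)
  · fin_cases k <;> simp [ksComplexCoord] <;> fun_prop
  · simp only [ksComplexCoord, Sum.elim_inr]; fun_prop

theorem ksComplexCoord_zero {κ : Type*} : ksComplexCoord (0 : Fin 4 ⊕ κ → ℝ) = 0 := by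
  funext k
  rcases k with k | k
  · fin_cases k <;> simp [ksComplexCoord]
  · simp [ksComplexCoord]

theorem AnalyticAt.exists_eq_comp_hopfInvariant_ksComplexCoord {κ : Type*} [Fintype κ]
    {f : (Fin 4 ⊕ κ → ℝ) → ℂ} (hf : AnalyticAt ℝ f 0) (hrot : ∀ θ s, f (ksRotation θ s) = f s) :
    ∃ g : (Fin 4 ⊕ κ → ℂ) → ℂ, AnalyticAt ℂ g 0 ∧
      ∀ᶠ s in 𝓝 (0 : Fin 4 ⊕ κ → ℝ), f s = g (hopfInvariant (ksComplexCoord s)) := by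
  obtain ⟨f₁, hf₁, h₁⟩ := hf.exists_complexification
  -- The complex-linear map recovering y from z₁, z̄₁, z₂, z̄₂.
  let L : (Fin 4 ⊕ κ → ℂ) → Fin 4 ⊕ κ → ℂ := fun t => Sum.elim
    ![(t (.inl 0) + t (.inl 1)) / 2, (t (.inl 2) + t (.inl 3)) / 2,
      (t (.inl 2) - t (.inl 3)) * (-Complex.I / 2), (t (.inl 0) - t (.inl 1)) * (-Complex.I / 2)]
    (t ∘ .inr)
  have hproj : ∀ k, AnalyticAt ℂ (fun t : Fin 4 ⊕ κ → ℂ => t k) 0 := fun k =>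
    (ContinuousLinearMap.proj (R := ℂ) (φ := fun _ : Fin 4 ⊕ κ => ℂ) k).analyticAt 0
  have hL : AnalyticAt ℂ L 0 := by
    refine analyticAt_pi_iff.2 ?_
    rintro (k | k)
    · fin_cases k
      · exact ((hproj _).add (hproj _)).div_const
      · exact ((hproj _).add (hproj _)).div_const
      · exact ((hproj _).sub (hproj _)).mul analyticAt_const
      · exact ((hproj _).sub (hproj _)).mul analyticAt_const
    · exact hproj _
  have hL0 : L 0 = 0 := by
    funext k
    rcases k with k | k
    · fin_cases k <;> simp [L]
    · simp [L]
  have hLs : ∀ s, L (ksComplexCoord s) = fun k => (s k : ℂ) := fun s => by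
    funext k
    rcases k with k | k
    · fin_cases k <;> simp [L, ksComplexCoord] <;> ring_nf <;> simp
    · rfl
  have hf₂ : AnalyticAt ℂ (f₁ ∘ L) 0 := AnalyticAt.comp (by rwa [hL0]) hL
  obtain ⟨g, hg, h⟩ := hf₂.exists_eq_comp_hopfInvariant
  refine ⟨g, hg, ?_⟩
  have htend : Tendsto (ksComplexCoord : (Fin 4 ⊕ κ → ℝ) → _) (𝓝 0) (𝓝 0) := by
    simpa only [ksComplexCoord_zero] using (continuous_ksComplexCoord (κ := κ)).tendsto 0
  obtain ⟨δ, hδ, hball⟩ := Metric.eventually_nhds_iff.1 h₁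
  -- Rotation may double the sup norm, so radius δ / 2 keeps the whole orbit where the
  -- complexification agrees with `f`.
  filter_upwards [htend.eventually h, Metric.ball_mem_nhds _ (half_pos hδ)] with s hs hsδ
  have hsδ' : ‖s‖ < δ / 2 := by simpa using hsδ
  have hval : ∀ s', ‖s'‖ < δ → (f₁ ∘ L) (ksComplexCoord s') = f s' := fun s' hs' => by
    rw [Function.comp, hLs]
    exact hball (by simpa using hs')
  rw [← hs, hval s (by linarith)]
  intro θ
  rw [hopfRotation_ksComplexCoord, hval s (by linarith), hval, hrot]
  linarith [norm_ksRotation_le θ s]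

/-! ### Fibres of the transform and the decomposition -/

theorem ksTransform_ksRotation {κ : Type*} (θ : ℝ) (s : Fin 4 ⊕ κ → ℝ) :
    ksTransform (WithLp.toLp 2 (ksRotation θ s ∘ .inl)) =
      ksTransform (WithLp.toLp 2 (s ∘ .inl)) := by
  have h := Real.sin_sq_add_cos_sq θ
  have h' : Real.sin θ ^ 2 = 1 - Real.cos θ ^ 2 := by linarith
  ext k
  fin_cases k <;>
    simp [ksTransform, ksRotation] <;> ring_nf <;> rw [h'] <;> ring

theorem exists_ksTransform_section : ∃ σ : EuclideanSpace ℝ (Fin 3) → Fin 4 → ℝ, ∀ x,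
    ksTransform (WithLp.toLp 2 (σ x)) = x ∧
      σ x 0 ^ 2 + σ x 1 ^ 2 + σ x 2 ^ 2 + σ x 3 ^ 2 = ‖x‖ := by
  refine ⟨_, fun x => Classical.choose_spec (p := fun y : Fin 4 → ℝ =>
    ksTransform (WithLp.toLp 2 y) = x ∧ y 0 ^ 2 + y 1 ^ 2 + y 2 ^ 2 + y 3 ^ 2 = ‖x‖) ?_⟩
  have hn : ‖x‖ ^ 2 = x 0 ^ 2 + x 1 ^ 2 + x 2 ^ 2 := by
    rw [EuclideanSpace.real_norm_sq_eq, Fin.sum_univ_three]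
  have h0 := norm_nonneg x
  set r := ‖x‖
  have hx0 : |x 0| ≤ r := abs_le_of_sq_le_sq (by nlinarith) h0
  obtain ⟨hx0l, hx0u⟩ := abs_le.1 hx0
  -- Choosing y₄ = 0 forces y₁² = (|x| + x₁)/2; y₂ and y₃ then follow by division, except on the ray
  -- where y₁ = 0.
  rcases (show 0 ≤ (r + x 0) / 2 by linarith).eq_or_lt with hA | hA
  · have hr : x 0 = -r := by linarith
    have h1 : x 1 = 0 := by nlinarith [sq_nonneg (x 1), sq_nonneg (x 2)]
    have h2 : x 2 = 0 := by nlinarith [sq_nonneg (x 1), sq_nonneg (x 2)]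
    refine ⟨![0, √r, 0, 0], ?_, by simp [Real.sq_sqrt h0]⟩
    ext k
    fin_cases k <;> simp [ksTransform, Real.sq_sqrt h0, hr, h1, h2]
  · set a := √((r + x 0) / 2)
    have ha : 0 < a := Real.sqrt_pos.2 hA
    have ha2 : a ^ 2 = (r + x 0) / 2 := Real.sq_sqrt hA.le
    have hb : (x 1 / (2 * a)) ^ 2 + (x 2 / (2 * a)) ^ 2 = (r - x 0) / 2 := by
      have : (x 1 / (2 * a)) ^ 2 + (x 2 / (2 * a)) ^ 2 = (x 1 ^ 2 + x 2 ^ 2) / (4 * a ^ 2) := by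
        field_simp; ring
      rw [this, ha2, div_eq_iff (by linarith)]
      nlinarith
    refine ⟨![a, x 1 / (2 * a), x 2 / (2 * a), 0], ?_, ?_⟩
    · ext k
      fin_cases k
      · simp [ksTransform]; linarith
      · simp [ksTransform]; field_simp
      · simp [ksTransform]; field_simp
    · simp; linarith

theorem hopfInvariant_ksComplexCoord {κ : Type*} {y : Fin 4 → ℝ} {x : EuclideanSpace ℝ (Fin 3)}
    (hx : ksTransform (WithLp.toLp 2 y) = x)
    (hy : y 0 ^ 2 + y 1 ^ 2 + y 2 ^ 2 + y 3 ^ 2 = ‖x‖) (v : κ → ℝ) :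
    hopfInvariant (ksComplexCoord (Sum.elim y v)) = Sum.elim
      ![((‖x‖ : ℂ) + x 0) / 2, ((‖x‖ : ℂ) - x 0) / 2, ((x 1 : ℂ) + x 2 * Complex.I) / 2,
        ((x 1 : ℂ) - x 2 * Complex.I) / 2] (fun k => (v k : ℂ)) := by
  rw [← hy, ← hx]
  funext k
  rcases k with k | k
  · fin_cases k <;>
      simp [hopfInvariant, ksComplexCoord, ksTransform] <;> ring_nf <;>
      simp only [Complex.I_sq] <;> ring
  · rfl

theorem AnalyticAt.exists_ksTransform_eq {κ : Type*} [Fintype κ]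
    {x₀' : EuclideanSpace ℝ κ} {ψ : EuclideanSpace ℝ (Fin 3) × EuclideanSpace ℝ κ → ℂ}
    (hψ : AnalyticAt ℝ (fun p : EuclideanSpace ℝ (Fin 4) × EuclideanSpace ℝ κ =>
      ψ (ksTransform p.1, p.2)) (0, x₀')) :
    ∃ ψ₁ ψ₂ : EuclideanSpace ℝ (Fin 3) × EuclideanSpace ℝ κ → ℂ,
      AnalyticAt ℝ ψ₁ (0, x₀') ∧ AnalyticAt ℝ ψ₂ (0, x₀') ∧
      ∀ᶠ p in 𝓝 ((0 : EuclideanSpace ℝ (Fin 3)), x₀'), ψ p = ψ₁ p + ((‖p.1‖ : ℝ) : ℂ) * ψ₂ p := by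
  let f : (Fin 4 ⊕ κ → ℝ) → ℂ := fun s =>
    ψ (ksTransform (WithLp.toLp 2 (s ∘ .inl)), x₀' + WithLp.toLp 2 (s ∘ .inr))
  have hf : AnalyticAt ℝ f 0 := by
    let P₁ : (Fin 4 ⊕ κ → ℝ) →L[ℝ] EuclideanSpace ℝ (Fin 4) :=
      (EuclideanSpace.equiv (Fin 4) ℝ).symm.toContinuousLinearMap.comp
        (ContinuousLinearMap.pi fun k => ContinuousLinearMap.proj (.inl k))
    let P₂ : (Fin 4 ⊕ κ → ℝ) →L[ℝ] EuclideanSpace ℝ κ :=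
      (EuclideanSpace.equiv κ ℝ).symm.toContinuousLinearMap.comp
        (ContinuousLinearMap.pi fun k => ContinuousLinearMap.proj (.inr k))
    have hP : AnalyticAt ℝ (fun s => (P₁ s, x₀' + P₂ s)) 0 :=
      (P₁.analyticAt 0).prod (analyticAt_const.add (P₂.analyticAt 0))
    have hP0 : ((0 : EuclideanSpace ℝ (Fin 4)), x₀') = (P₁ 0, x₀' + P₂ 0) := by
      rw [map_zero, map_zero, add_zero]
    rw [hP0] at hψ
    have hfP : f = (fun p : EuclideanSpace ℝ (Fin 4) × EuclideanSpace ℝ κ =>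
        ψ (ksTransform p.1, p.2)) ∘ fun s => (P₁ s, x₀' + P₂ s) := by
      funext s; rfl
    rw [hfP]
    exact AnalyticAt.comp hψ hP
  have hrot : ∀ θ s, f (ksRotation θ s) = f s := fun θ s => by
    simp only [f, ksTransform_ksRotation]
    rfl
  obtain ⟨g, hg, hfg⟩ := hf.exists_eq_comp_hopfInvariant_ksComplexCoord hrot
  -- The invariants as linear functions of (|x|, x, x' - x₀'), with |x| replaced by an independent
  -- variable.
  let Q : (Fin 1 ⊕ (Fin 3 ⊕ κ) → ℂ) → Fin 4 ⊕ κ → ℂ := fun t => Sum.elim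
    ![(t (.inl 0) + t (.inr (.inl 0))) / 2, (t (.inl 0) - t (.inr (.inl 0))) / 2,
      (t (.inr (.inl 1)) + t (.inr (.inl 2)) * Complex.I) / 2,
      (t (.inr (.inl 1)) - t (.inr (.inl 2)) * Complex.I) / 2] (fun k => t (.inr (.inr k)))
  have hQ : AnalyticAt ℂ Q 0 := by
    have hproj : ∀ k, AnalyticAt ℂ (fun t : Fin 1 ⊕ (Fin 3 ⊕ κ) → ℂ => t k) 0 := fun k =>
      (ContinuousLinearMap.proj (R := ℂ) (φ := fun _ : Fin 1 ⊕ (Fin 3 ⊕ κ) => ℂ) k).analyticAt 0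
    refine analyticAt_pi_iff.2 ?_
    rintro (k | k)
    · fin_cases k
      · exact ((hproj _).add (hproj _)).div_const
      · exact ((hproj _).sub (hproj _)).div_const
      · exact ((hproj _).add ((hproj _).mul analyticAt_const)).div_const
      · exact ((hproj _).sub ((hproj _).mul analyticAt_const)).div_const
    · exact hproj _
  have hQ0 : Q 0 = 0 := by
    funext k
    rcases k with k | k
    · fin_cases k <;> simp [Q]
    · simp [Q]
  have hgQ : AnalyticAt ℂ (g ∘ Q) 0 := AnalyticAt.comp (by rwa [hQ0]) hQ
  obtain ⟨g₀, g₁, hg₀, hg₁, hgg⟩ := hgQ.exists_even_odd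
  let Φ : EuclideanSpace ℝ (Fin 3) × EuclideanSpace ℝ κ →
      Fin 1 ⊕ (Fin 3 ⊕ κ) → ℂ := fun p => Sum.elim (fun _ => ∑ k, (p.1 k : ℂ) ^ 2)
    (Sum.elim (fun k => (p.1 k : ℂ)) (fun k => ((p.2 - x₀') k : ℂ)))
  have hΦ : AnalyticAt ℝ Φ (0, x₀') := by
    have h1 : ∀ k, AnalyticAt ℝ (fun p : EuclideanSpace ℝ (Fin 3) × EuclideanSpace ℝ κ =>
        (p.1 k : ℂ)) (0, x₀') := fun k =>
      (Complex.ofRealCLM.comp ((EuclideanSpace.proj k).comp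
        (ContinuousLinearMap.fst ℝ (EuclideanSpace ℝ (Fin 3)) (EuclideanSpace ℝ κ)))).analyticAt
          (0, x₀')
    have h2 : ∀ k, AnalyticAt ℝ (fun p : EuclideanSpace ℝ (Fin 3) × EuclideanSpace ℝ κ =>
        ((p.2 - x₀') k : ℂ)) (0, x₀') := fun k => by
      have := ((Complex.ofRealCLM.comp ((EuclideanSpace.proj k).comp
        (ContinuousLinearMap.snd ℝ (EuclideanSpace ℝ (Fin 3)) (EuclideanSpace ℝ κ)))).analyticAt
          (0, x₀')).sub (analyticAt_const (v := ((x₀' k : ℝ) : ℂ)))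
      convert this using 2 with p
      simp
    refine analyticAt_pi_iff.2 ?_
    rintro (k | k | k)
    · exact Finset.analyticAt_fun_sum _ fun k _ => (h1 k).pow 2
    · exact h1 k
    · exact h2 k
  have hΦ0 : Φ (0, x₀') = 0 := by
    funext k
    rcases k with k | k | k <;> simp [Φ]
  refine ⟨g₀ ∘ Φ, g₁ ∘ Φ, AnalyticAt.comp (by rw [hΦ0]; exact hg₀.restrictScalars) hΦ,
    AnalyticAt.comp (by rw [hΦ0]; exact hg₁.restrictScalars) hΦ, ?_⟩
  obtain ⟨σ, hσ⟩ := exists_ksTransform_section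
  -- The section need not be continuous elsewhere; |σ(x)|² = |x| gives the limit at 0, which
  -- suffices.
  have hσ0 : Tendsto σ (𝓝 0) (𝓝 0) := by
    refine tendsto_pi_nhds.2 fun k => ?_
    have hsq : Tendsto (fun x => √‖x‖) (𝓝 (0 : EuclideanSpace ℝ (Fin 3))) (𝓝 0) := by
      have : Continuous fun x : EuclideanSpace ℝ (Fin 3) => √‖x‖ := by fun_prop
      simpa using this.tendsto 0
    refine squeeze_zero_norm (fun x => Real.le_sqrt_of_sq_le ?_) hsq
    rw [Real.norm_eq_abs, sq_abs, ← (hσ x).2]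
    fin_cases k <;> simp <;> nlinarith [sq_nonneg (σ x 0), sq_nonneg (σ x 1),
      sq_nonneg (σ x 2), sq_nonneg (σ x 3)]
  let S : EuclideanSpace ℝ (Fin 3) × EuclideanSpace ℝ κ → Fin 4 ⊕ κ → ℝ := fun p => Sum.elim (σ p.1) (fun k => (p.2 - x₀') k)
  have hS : Tendsto S (𝓝 (0, x₀')) (𝓝 0) := by
    refine tendsto_pi_nhds.2 ?_
    rintro (k | k)
    · exact (tendsto_pi_nhds.1 hσ0 k).comp (continuous_fst.tendsto' (0, x₀') _ rfl)
    · have : Continuous fun p : EuclideanSpace ℝ (Fin 3) × EuclideanSpace ℝ κ => (p.2 - x₀') k := by fun_prop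
      exact this.tendsto' _ _ (by simp)
  let T : EuclideanSpace ℝ (Fin 3) × EuclideanSpace ℝ κ →
      Fin 1 ⊕ (Fin 3 ⊕ κ) → ℂ := fun p => Sum.elim (fun _ => ((‖p.1‖ : ℝ) : ℂ))
    (Sum.elim (fun k => (p.1 k : ℂ)) (fun k => ((p.2 - x₀') k : ℂ)))
  have hT : Tendsto T (𝓝 (0, x₀')) (𝓝 0) := by
    have : Continuous T := by
      refine continuous_pi ?_
      rintro (k | k | k) <;> simp only [T, Sum.elim_inl, Sum.elim_inr] <;> fun_prop
    refine this.tendsto' _ _ ?_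
    funext k
    rcases k with k | k | k <;> simp [T]
  filter_upwards [hS.eventually hfg, hT.eventually hgg] with p h1 h2
  have hfS : f (S p) = ψ p := by
    have e1 : S p ∘ .inl = σ p.1 := rfl
    have e2 : x₀' + WithLp.toLp 2 (S p ∘ .inr) = p.2 := by
      ext k; simp [S]
    simp only [f, e2, e1, (hσ p.1).1]
  have hTQ : hopfInvariant (ksComplexCoord (S p)) = Q (T p) :=
    hopfInvariant_ksComplexCoord (hσ p.1).1 (hσ p.1).2 _
  have hΦT : (Sum.elim (fun _ => T p (.inl 0) ^ 2) (T p ∘ .inr) : Fin 1 ⊕ (Fin 3 ⊕ κ) → ℂ) =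
      Φ p := by
    have : ((‖p.1‖ : ℝ) : ℂ) ^ 2 = ∑ k, (p.1 k : ℂ) ^ 2 := by
      rw [← Complex.ofReal_pow, EuclideanSpace.real_norm_sq_eq]; push_cast; rfl
    funext k
    rcases k with k | k
    · exact this
    · rfl
  rw [← hfS, h1, hTQ]
  rw [hΦT] at h2
  exact h2

theorem proposition4p2 (N : ℕ) (hN : 1 ≤ N)
    (U : Set (EuclideanSpace ℝ (Fin 3)))
    (U' : Set (EuclideanSpace ℝ (Fin (3 * N - 3))))
    (hU : IsOpen U) (hU' : IsOpen U')
    (h0 : (0 : EuclideanSpace ℝ (Fin 3)) ∈ U)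
    (x₀' : EuclideanSpace ℝ (Fin (3 * N - 3))) (hx₀' : x₀' ∈ U')
    (ψ : EuclideanSpace ℝ (Fin 3) × EuclideanSpace ℝ (Fin (3 * N - 3)) → ℂ)
    (hψ : AnalyticOnNhd ℝ
      (fun p : EuclideanSpace ℝ (Fin 4) × EuclideanSpace ℝ (Fin (3 * N - 3)) =>
        ψ (ksTransform p.1, p.2))
      ((ksTransform ⁻¹' U) ×ˢ U')) :
    ∃ (W : Set (EuclideanSpace ℝ (Fin 3) × EuclideanSpace ℝ (Fin (3 * N - 3))))
      (ψ₁ ψ₂ : EuclideanSpace ℝ (Fin 3) × EuclideanSpace ℝ (Fin (3 * N - 3)) → ℂ),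
      IsOpen W ∧ ((0 : EuclideanSpace ℝ (Fin 3)), x₀') ∈ W ∧ W ⊆ U ×ˢ U' ∧
      AnalyticOnNhd ℝ ψ₁ W ∧ AnalyticOnNhd ℝ ψ₂ W ∧
      ∀ p ∈ W, ψ p = ψ₁ p + ((‖p.1‖ : ℝ) : ℂ) * ψ₂ p := by
  have hK0 : ksTransform 0 = 0 := by
    ext k
    fin_cases k <;> simp [ksTransform]
  obtain ⟨ψ₁, ψ₂, h₁, h₂, h⟩ := AnalyticAt.exists_ksTransform_eq
    (hψ (0, x₀') ⟨by rwa [Set.mem_preimage, hK0], hx₀'⟩)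
  have hU₀ : U ×ˢ U' ∈ 𝓝 ((0 : EuclideanSpace ℝ (Fin 3)), x₀') :=
    (hU.prod hU').mem_nhds ⟨h0, hx₀'⟩
  obtain ⟨W, hW, hWo, hmem⟩ := eventually_nhds_iff.1
    ((h.and hU₀).and (h₁.eventually_analyticAt.and h₂.eventually_analyticAt))
  exact ⟨W, ψ₁, ψ₂, hWo, hmem, fun p hp => (hW p hp).1.2, fun p hp => (hW p hp).2.1,
    fun p hp => (hW p hp).2.2, fun p hp => (hW p hp).1.1⟩
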